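/- Let $(\Omega,\mathcal F)$ be a measurable space, $X_1,X_2,\dots$ real random variables on it, and $\delta,C,\rho>0$. For $q\ge 1$ and $\theta\in\mathbb R$ let $\mathcal M_q(\theta)$ be the set of probability distributions on $\mathbb R$ with mean $\theta$ and finite $q$-th moment. Let $\mathcal P$ be a set of probability measures on $(\Omega,\mathcal F)$ and, for each $P\in\mathcal P$, let $\mu(P)\in\mathbb R$ (for instance $\mu(P)=\mu$, the same number for every $P$); suppose that under each $P\in\mathcal P$ the $X_i$ are iid with law in $\mathcal M_{2+\delta}(\mu(P))$. For a family of random sets $\mathcal H=(\mathcal H(\alpha))_{\alpha>0}$ define the post-hoc risk $$\mathbf R(\mathcal H;\theta,P)=\mathbb E_P\Big[\sup_{\alpha>0}\frac{\mathbf 1\{\theta\notin\mathcal H(\alpha)\}}{\alpha}\Big].$$ A sequence $(\mathcal H_n)$ is an asymptotic post-hoc confidence interval (CI) for $\mu$ under $\mathcal P$ if $\sup_{P\in\mathcal P}\limsup_{n\to\infty}\mathbf R(\mathcal H_n;\mu(P),P)\le 1$, and a $\mathcal P$-uniform asymptotic post-hoc CI for $\mu$ if $\limsup_{n\to\infty}\sup_{P\in\mathcal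 P}\mathbf R(\mathcal H_n;\mu(P),P)\le 1$. Let $\overline X_n=\frac1n\sum_{i\le n}X_i$, $\hat s_n^2=\frac1n\sum_{i\le n}(X_i-\overline X_n)^2$, $\hat u_n=n\big(\hat s_n^2+\frac1{\log n}\big)$, and $$W_n(\alpha)=\sqrt{\frac{2\rho\hat u_n+2}{n^2\rho}\,\log\Big(\frac{\sqrt{\rho\hat u_n+1}}{\alpha}\Big)},$$ with $W_n(\alpha)=0$ if the logarithm is negative. Let $\mathcal H_n(\alpha)$ be the open interval $(\overline X_n-W_n(\alpha),\,\overline X_n+W_n(\alpha))$ if $C n^{0.24\,\delta}\ge 1/\alpha$, and $\mathcal H_n(\alpha)=\mathbb R$ otherwise. Then $(\mathcal H_n)$ is an asymptotic post-hoc CI for $\mu$ under $\mathcal P$. If moreover $\sup_{P\in\mathcal P}\mathbb E_P|X_1|^{2+\delta}<\infty$, then $(\mathcal H_n)$ is a $\mathcal P$-uniform asymptotic post-hoc CI for $\mu$. -/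

import Mathlib

open MeasureTheory ProbabilityTheory Filter
open scoped ENNReal

noncomputable section

/-- The class `M_q(θ)` of probability distributions on `ℝ` with mean `θ` and finite `q`-th moment. -/
def momentClass (q θ : ℝ) : Set (Measure ℝ) :=
  {Q | IsProbabilityMeasure Q ∧ Integrable (fun x : ℝ => x) Q ∧ ∫ x, x ∂Q = θ ∧
    Integrable (fun x : ℝ => |x - θ| ^ q) Q}

/-- `X 0, X 1, …` are iid random variables under the probability measure `P`. -/
structure IsIID {Ω : Type*} [MeasurableSpace Ω] (X : ℕ → Ω → ℝ) (P : Measure Ω) : Prop where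
  isProbabilityMeasure : IsProbabilityMeasure P
  measurable : ∀ i, Measurable (X i)
  indep : iIndepFun X P
  identDistrib : ∀ i, IdentDistrib (X i) (X 0) P P

/-- The sequence has a uniformly bounded `q`-th moment over the family `𝔓`
(all terms have the same law as `X 0`). -/
def HasUniformlyBoundedMoment {Ω : Type*} [MeasurableSpace Ω] (X : ℕ → Ω → ℝ) (q : ℝ)
    (𝔓 : Set (Measure Ω)) : Prop :=
  (⨆ P ∈ 𝔓, ∫⁻ ω, ENNReal.ofReal (|X 0 ω| ^ q) ∂P) < ∞

/-- The post-hoc loss `sup_{α > 0} 1{θ ∉ H(α)} / α` of a family of sets `H(α)`. -/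
def postHocLoss (H : ℝ → Set ℝ) (θ : ℝ) : ℝ≥0∞ :=
  ⨆ (α : ℝ) (_ : 0 < α), (H α)ᶜ.indicator (fun _ => ENNReal.ofReal (1 / α)) θ

/-- The post-hoc risk `E_P[sup_{α > 0} 1{θ ∉ H(α)} / α]` of a family of random sets. -/
def postHocRisk {Ω : Type*} [MeasurableSpace Ω] (H : Ω → ℝ → Set ℝ) (θ : ℝ) (P : Measure Ω) :
    ℝ≥0∞ :=
  ∫⁻ ω, postHocLoss (H ω) θ ∂P

/-- `H` is a (pointwise) asymptotic post-hoc confidence interval for the estimand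
`θ = (θ P)_{P ∈ 𝔓}`: `sup_{P ∈ 𝔓} limsup_n R(H_n; θ(P), P) ≤ 1`. The first clause says that the
expectation defining the risk is one of a measurable function. -/
def IsAsympPostHocCI {Ω : Type*} [MeasurableSpace Ω] (H : ℕ → Ω → ℝ → Set ℝ)
    (θ : Measure Ω → ℝ) (𝔓 : Set (Measure Ω)) : Prop :=
  (∀ n, 1 ≤ n → ∀ P ∈ 𝔓, AEMeasurable (fun ω => postHocLoss (H n ω) (θ P)) P) ∧
    (⨆ P ∈ 𝔓, limsup (fun n => postHocRisk (H n) (θ P) P) atTop) ≤ 1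

/-- `H` is a `𝔓`-uniform asymptotic post-hoc confidence interval for the estimand
`θ = (θ P)_{P ∈ 𝔓}`: `limsup_n sup_{P ∈ 𝔓} R(H_n; θ(P), P) ≤ 1`. -/
def IsUniformAsympPostHocCI {Ω : Type*} [MeasurableSpace Ω] (H : ℕ → Ω → ℝ → Set ℝ)
    (θ : Measure Ω → ℝ) (𝔓 : Set (Measure Ω)) : Prop :=
  (∀ n, 1 ≤ n → ∀ P ∈ 𝔓, AEMeasurable (fun ω => postHocLoss (H n ω) (θ P)) P) ∧
    limsup (fun n => ⨆ P ∈ 𝔓, postHocRisk (H n) (θ P) P) atTop ≤ 1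

/-- The mean of the first `n` observations `X 0, …, X (n - 1)`. -/
def sampleMean {Ω : Type*} (X : ℕ → Ω → ℝ) (n : ℕ) (ω : Ω) : ℝ :=
  (∑ i ∈ Finset.range n, X i ω) / n

/-- The biased sample variance `ŝ_n²` of the first `n` observations. -/
def biasedSampleVar {Ω : Type*} (X : ℕ → Ω → ℝ) (n : ℕ) (ω : Ω) : ℝ :=
  (∑ i ∈ Finset.range n, (X i ω - sampleMean X n ω) ^ 2) / n

/-- `û_n = n (ŝ_n² + 1 / log n)`. -/
def uHat {Ω : Type*} (X : ℕ → Ω → ℝ) (n : ℕ) (ω : Ω) : ℝ :=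
  n * (biasedSampleVar X n ω + 1 / Real.log n)

/-- The half-width `W_n(α; ρ)`. Where the logarithm is negative, `Real.sqrt` makes this `0`, and the
open interval below is empty. -/
def rwsWidth {Ω : Type*} (X : ℕ → Ω → ℝ) (ρ : ℝ) (n : ℕ) (ω : Ω) (α : ℝ) : ℝ :=
  Real.sqrt ((2 * ρ * uHat X n ω + 2) / ((n : ℝ) ^ 2 * ρ) *
    Real.log (Real.sqrt (ρ * uHat X n ω + 1) / α))

/-- The truncated interval `H_n(α; ρ)`: the open interval `X̄_n ± W_n(α; ρ)` if
`C n ^ (0.24 δ) ≥ 1 / α`, and the whole line otherwise. -/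
def rwsInterval {Ω : Type*} (X : ℕ → Ω → ℝ) (δ C ρ : ℝ) (n : ℕ) (ω : Ω) (α : ℝ) : Set ℝ :=
  if 1 / α ≤ C * (n : ℝ) ^ (0.24 * δ) then
    Set.Ioo (sampleMean X n ω - rwsWidth X ρ n ω α) (sampleMean X n ω + rwsWidth X ρ n ω α)
  else Set.univ

end

/-!
The post-hoc loss of the truncated interval is `min (E_n, C n ^ (0.24 δ))`, where the e-value `E_n`
is the Gaussian mixture `∫ exp (l S - l² û_n / 2) dN(0, ρ)(l)` in closed form and `S` is the sum of
the centred observations (`postHocLoss_rwsInterval`). The risk turns out to tend to `0`, because the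
cap discards the part of the mixture with `l` far from the scale `n ^ (-1/2)`.

More precisely, let `p = min (2 + δ, 3)` and let `Λ` be a cut-off slightly larger than `n ^ (-1/2)`.
Up to a constant, the capped e-value is at most the mixture of `exp (l S - l² û_n / 2)` over
`|l| ≤ Λ` under Lebesgue measure (`min_mixtureEValue_le`): if the maximiser `S / û_n` of the exponent
is at most `Λ`, Laplace's method gives back `E_n`, and otherwise the mixture is larger than any power
of `n`, since `û_n ≥ n / log n`; this is the purpose of the term `1 / log n`. If `û_n` is at least
the centred sum of squares `V`, it may be replaced by `V`. The inequality
`exp (y - y² / 2) ≤ 1 + y + 16 |y| ^ p` then bounds the mean of the integrand at `l` by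
`exp (16 n |l| ^ p E|X - μ| ^ p)` (`lintegral_exp_selfNormalized_le`), which is bounded for
`|l| ≤ Λ`, and the mean of the mixture is `O(Λ)`.

Since `û_n = V - S² / n + n / log n`, the inequality `û_n < V` forces `|S| > n ^ 0.95` for large `n`.
Either `V > n ^ 1.5`, which has probability `O(n ^ (-(2 + δ) / 4))` by Markov's inequality
(`measure_sum_sq_gt_le`) and is negligible after multiplication by the cap as
`0.24 δ < (2 + δ) / 4`, or the same exponential bound at a single `l` shows that the probability is
exponentially small (`measure_sum_gt_le`). All constants depend on the law of the observations only
through a bound on the centred `(2 + δ)`-th moment, which gives both the pointwise and the uniform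
statement (`postHocRisk_rwsInterval_le`).
-/

/-! ### Closed form of the post-hoc loss -/

/-- The e-value behind the interval, as a function of the sample mean `x`, the variance proxy `u`
and the hypothesised mean `θ`: the Gaussian mixture
`∫ exp (l s - l² u / 2) dN(0, ρ)(l)` with `s = n (x - θ)`, in closed form. -/
noncomputable def mixtureEValue (ρ : ℝ) (n : ℕ) (u x θ : ℝ) : ℝ :=
  Real.exp ((n : ℝ) ^ 2 * ρ * (θ - x) ^ 2 / (2 * ρ * u + 2)) / Real.sqrt (ρ * u + 1)

lemma mixtureEValue_pos {ρ u : ℝ} (hρ : 0 < ρ) (hu : 0 ≤ u) (n : ℕ) (x θ : ℝ) :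
    0 < mixtureEValue ρ n u x θ := by
  unfold mixtureEValue
  have : 0 < ρ * u + 1 := by positivity
  positivity

lemma biasedSampleVar_nonneg {Ω : Type*} (X : ℕ → Ω → ℝ) (n : ℕ) (ω : Ω) :
    0 ≤ biasedSampleVar X n ω :=
  div_nonneg (Finset.sum_nonneg fun _ _ => sq_nonneg _) (Nat.cast_nonneg _)

lemma uHat_nonneg {Ω : Type*} (X : ℕ → Ω → ℝ) (n : ℕ) (ω : Ω) : 0 ≤ uHat X n ω := by
  have h1 := biasedSampleVar_nonneg X n ω
  have h2 := Real.log_natCast_nonneg n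
  unfold uHat
  positivity

/-- A point lies outside the untruncated interval at level `α` exactly when the e-value at that
point is at least `1 / α`. -/
lemma notMem_Ioo_rwsWidth_iff {Ω : Type*} (X : ℕ → Ω → ℝ) {ρ : ℝ} (hρ : 0 < ρ) {n : ℕ}
    (hn : 1 ≤ n) (ω : Ω) {α : ℝ} (hα : 0 < α) (θ : ℝ) :
    θ ∉ Set.Ioo (sampleMean X n ω - rwsWidth X ρ n ω α) (sampleMean X n ω + rwsWidth X ρ n ω α) ↔
      1 / α ≤ mixtureEValue ρ n (uHat X n ω) (sampleMean X n ω) θ := by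
  have hu := uHat_nonneg X n ω
  unfold rwsWidth mixtureEValue
  set u := uHat X n ω
  set x := sampleMean X n ω
  have hn' : (0 : ℝ) < n := by exact_mod_cast hn
  have hv : 0 < Real.sqrt (ρ * u + 1) := Real.sqrt_pos.2 (by positivity)
  have hA : 0 < (2 * ρ * u + 2) / ((n : ℝ) ^ 2 * ρ) := by positivity
  set W := Real.sqrt ((2 * ρ * u + 2) / ((n : ℝ) ^ 2 * ρ) * Real.log (Real.sqrt (ρ * u + 1) / α))
    with hW
  have h1 : θ ∉ Set.Ioo (x - W) (x + W) ↔ W ≤ |θ - x| := by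
    rw [← not_lt, not_iff_not, abs_lt, Set.mem_Ioo]
    constructor <;> rintro ⟨h1, h2⟩ <;> constructor <;> linarith
  rw [h1, hW, Real.sqrt_le_iff, sq_abs, and_iff_right (abs_nonneg _), mul_comm, ← le_div_iff₀ hA,
    Real.log_le_iff_le_exp (by positivity), le_div_iff₀ hv, one_div_mul_eq_div]
  have : (θ - x) ^ 2 / ((2 * ρ * u + 2) / ((n : ℝ) ^ 2 * ρ)) =
      (n : ℝ) ^ 2 * ρ * (θ - x) ^ 2 / (2 * ρ * u + 2) := by
    field_simp
  rw [this]

/-- The post-hoc loss of the truncated interval is the e-value capped at the truncation level. -/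
lemma postHocLoss_rwsInterval {Ω : Type*} (X : ℕ → Ω → ℝ) {δ C ρ : ℝ} (hC : 0 < C) (hρ : 0 < ρ)
    {n : ℕ} (hn : 1 ≤ n) (ω : Ω) (θ : ℝ) :
    postHocLoss (rwsInterval X δ C ρ n ω) θ =
      ENNReal.ofReal (min (mixtureEValue ρ n (uHat X n ω) (sampleMean X n ω) θ)
        (C * (n : ℝ) ^ (0.24 * δ))) := by
  have hn' : (0 : ℝ) < n := by exact_mod_cast hn
  have hE := mixtureEValue_pos hρ (uHat_nonneg X n ω) n (sampleMean X n ω) θ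
  have hc : 0 < C * (n : ℝ) ^ (0.24 * δ) := by positivity
  have key : ∀ α : ℝ, 0 < α → (θ ∈ (rwsInterval X δ C ρ n ω α)ᶜ ↔
      1 / α ≤ min (mixtureEValue ρ n (uHat X n ω) (sampleMean X n ω) θ)
        (C * (n : ℝ) ^ (0.24 * δ))) := by
    intro α hα
    rw [le_min_iff, ← notMem_Ioo_rwsWidth_iff X hρ hn ω hα θ]
    unfold rwsInterval
    split_ifs with h
    · exact (and_iff_left h).symm
    · simp only [Set.compl_univ, Set.mem_empty_iff_false, false_iff]
      exact fun h' => h h'.2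
  unfold postHocLoss
  set m := min (mixtureEValue ρ n (uHat X n ω) (sampleMean X n ω) θ)
        (C * (n : ℝ) ^ (0.24 * δ)) with hm
  have hmpos : 0 < m := lt_min hE hc
  apply le_antisymm
  · refine iSup₂_le fun α hα => ?_
    by_cases h : θ ∈ (rwsInterval X δ C ρ n ω α)ᶜ
    · rw [Set.indicator_of_mem h]
      exact ENNReal.ofReal_le_ofReal ((key α hα).1 h)
    · rw [Set.indicator_of_notMem h]
      exact zero_le
  · refine le_iSup₂_of_le (1 / m) (by positivity) ?_
    rw [Set.indicator_of_mem ((key _ (by positivity)).2 (by rw [one_div_one_div])), one_div_one_div]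

lemma measurable_sampleMean {Ω : Type*} [MeasurableSpace Ω] {X : ℕ → Ω → ℝ}
    (hX : ∀ i, Measurable (X i)) (n : ℕ) : Measurable (sampleMean X n) := by
  unfold sampleMean
  fun_prop

lemma measurable_uHat {Ω : Type*} [MeasurableSpace Ω] {X : ℕ → Ω → ℝ}
    (hX : ∀ i, Measurable (X i)) (n : ℕ) : Measurable (uHat X n) := by
  have := measurable_sampleMean hX n
  unfold uHat biasedSampleVar
  fun_prop

lemma measurable_postHocLoss_rwsInterval {Ω : Type*} [MeasurableSpace Ω] {X : ℕ → Ω → ℝ}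
    (hX : ∀ i, Measurable (X i)) {δ C ρ : ℝ} (hC : 0 < C) (hρ : 0 < ρ) {n : ℕ} (hn : 1 ≤ n)
    (θ : ℝ) : Measurable fun ω => postHocLoss (rwsInterval X δ C ρ n ω) θ := by
  have h1 := measurable_sampleMean hX n
  have h2 := measurable_uHat hX n
  simp_rw [postHocLoss_rwsInterval X hC hρ hn]
  unfold mixtureEValue
  fun_prop

/-- The decomposition of `n ŝ_n²` around an arbitrary centre `θ`. -/
lemma uHat_eq {Ω : Type*} (X : ℕ → Ω → ℝ) {n : ℕ} (hn : 1 ≤ n) (ω : Ω) (θ : ℝ) :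
    uHat X n ω = ∑ i ∈ Finset.range n, (X i ω - θ) ^ 2 -
      (∑ i ∈ Finset.range n, (X i ω - θ)) ^ 2 / n + n / Real.log n := by
  have hn' : (n : ℝ) ≠ 0 := by positivity
  unfold uHat biasedSampleVar sampleMean
  simp only [sub_sq, Finset.sum_add_distrib, Finset.sum_sub_distrib, ← Finset.sum_mul,
    ← Finset.mul_sum, Finset.sum_const, Finset.card_range, nsmul_eq_mul]
  rcases eq_or_ne (Real.log n) 0 with h | h
  · simp only [h, div_zero, add_zero]
    field_simp
    ring
  · field_simp
    ring

lemma mul_sub_sampleMean {Ω : Type*} (X : ℕ → Ω → ℝ) {n : ℕ} (hn : 1 ≤ n) (ω : Ω) (θ : ℝ) :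
    (n : ℝ) * (sampleMean X n ω - θ) = ∑ i ∈ Finset.range n, (X i ω - θ) := by
  have hn' : (n : ℝ) ≠ 0 := by positivity
  unfold sampleMean
  rw [Finset.sum_sub_distrib, Finset.sum_const, Finset.card_range, nsmul_eq_mul]
  field_simp

/-! ### Exponential moments of self-normalised sums -/

/-- The second-order terms of `exp (y - y² / 2)` cancel, so that it differs from `1 + y` by
`O(|y| ^ p)` near `0` as soon as `p ≤ 3`; away from `0` it is bounded. -/
lemma exp_sub_half_sq_le {p : ℝ} (hp : 1 ≤ p) (hp3 : p ≤ 3) (y : ℝ) :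
    Real.exp (y - y ^ 2 / 2) ≤ 1 + y + 16 * |y| ^ p := by
  have hexp2 : Real.exp (y - y ^ 2 / 2) ≤ 2 := by
    have h1 : y - y ^ 2 / 2 ≤ Real.log 2 := by nlinarith [Real.log_two_gt_d9, sq_nonneg (y - 1)]
    calc _ ≤ Real.exp (Real.log 2) := Real.exp_le_exp.2 h1
      _ = 2 := Real.exp_log (by norm_num)
  have hy0 := abs_nonneg y
  by_cases hy1 : 1 ≤ |y|
  · have h2 : |y| ≤ |y| ^ p := by
      simpa using Real.rpow_le_rpow_of_exponent_le hy1 hp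
    nlinarith [neg_abs_le y]
  push Not at hy1
  have h3 : |y| ^ 3 ≤ |y| ^ p := by
    rcases hy0.eq_or_lt with h | h
    · rw [← h]; simp [Real.zero_rpow (by linarith : p ≠ 0)]
    · simpa using Real.rpow_le_rpow_of_exponent_ge h hy1.le hp3
  by_cases hy2 : 1 / 2 ≤ |y|
  · have h4 : (1 / 2 : ℝ) ^ 3 ≤ |y| ^ 3 := pow_le_pow_left₀ (by norm_num) hy2 3
    nlinarith [neg_abs_le y]
  push Not at hy2
  set z := y - y ^ 2 / 2 with hz
  have hz1 : |z| ≤ 5 / 4 * |y| := by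
    have : z = y * (1 - y / 2) := by rw [hz]; ring
    rw [this, abs_mul, mul_comm]
    refine mul_le_mul_of_nonneg_right ?_ hy0
    rw [abs_le]
    constructor <;> linarith [abs_le.1 hy2.le]
  have hb := Real.exp_bound (x := z) (by linarith) (n := 3) (by norm_num)
  have hb' := (abs_le.1 hb).2
  have hz3 : |z| ^ 3 ≤ (5 / 4 * |y|) ^ 3 := pow_le_pow_left₀ (abs_nonneg z) hz1 3
  have hy4 : y ^ 4 ≤ |y| ^ 3 := by
    have : y ^ 4 = |y| ^ 3 * |y| := by
      rw [← pow_succ]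
      exact (Even.pow_abs (by decide) y).symm
    rw [this]
    nlinarith [pow_nonneg hy0 3]
  have hy3 : -y ^ 3 ≤ |y| ^ 3 := by
    rw [← abs_pow]; exact neg_le_abs _
  have hsum : ∑ m ∈ Finset.range 3, z ^ m / (m.factorial : ℝ) = 1 + z + z ^ 2 / 2 := by
    simp [Finset.sum_range_succ]
  have hzz : 1 + z + z ^ 2 / 2 = 1 + y - y ^ 3 / 2 + y ^ 4 / 8 := by rw [hz]; ring
  rw [hsum, hzz] at hb'
  norm_num at hb'
  nlinarith [pow_nonneg hy0 3]


section

variable {Ω : Type*} [MeasurableSpace Ω]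

/-- The linear term of the preceding bound has mean zero, which leaves `1 + 16 |l| ^ p E|Y| ^ p`. -/
lemma lintegral_exp_sub_half_sq_le {P : Measure Ω} [IsProbabilityMeasure P] {Y : Ω → ℝ}
    (hint : Integrable Y P) (hmean : ∫ ω, Y ω ∂P = 0)
    {p m : ℝ} (hp : 1 ≤ p) (hp3 : p ≤ 3) (hYp : Integrable (fun ω => |Y ω| ^ p) P)
    (hm : ∫ ω, |Y ω| ^ p ∂P ≤ m) (l : ℝ) :
    ∫⁻ ω, ENNReal.ofReal (Real.exp (l * Y ω - l ^ 2 * Y ω ^ 2 / 2)) ∂P ≤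
      ENNReal.ofReal (Real.exp (16 * |l| ^ p * m)) := by
  have hpt : ∀ ω, Real.exp (l * Y ω - l ^ 2 * Y ω ^ 2 / 2) ≤
      1 + l * Y ω + 16 * |l| ^ p * |Y ω| ^ p := fun ω => by
    have := exp_sub_half_sq_le hp hp3 (l * Y ω)
    rwa [abs_mul, Real.mul_rpow (abs_nonneg _) (abs_nonneg _), mul_pow, ← mul_assoc] at this
  have hi1 : Integrable (fun ω => 1 + l * Y ω) P := (integrable_const _).add (hint.const_mul l)
  have hi2 : Integrable (fun ω => 16 * |l| ^ p * |Y ω| ^ p) P := hYp.const_mul _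
  calc _ ≤ ∫⁻ ω, ENNReal.ofReal (1 + l * Y ω + 16 * |l| ^ p * |Y ω| ^ p) ∂P :=
        lintegral_mono fun ω => ENNReal.ofReal_le_ofReal (hpt ω)
    _ = ENNReal.ofReal (∫ ω, (1 + l * Y ω + 16 * |l| ^ p * |Y ω| ^ p) ∂P) :=
        (ofReal_integral_eq_lintegral_ofReal (hi1.add hi2)
          (ae_of_all _ fun ω => (Real.exp_pos _).le.trans (hpt ω))).symm
    _ ≤ _ := by
        refine ENNReal.ofReal_le_ofReal ?_
        rw [integral_add hi1 hi2, integral_add (integrable_const _) (hint.const_mul l),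
          integral_const_mul, integral_const_mul, hmean]
        simp only [integral_const, probReal_univ, smul_eq_mul, mul_one, mul_zero, add_zero]
        have h1 : 16 * |l| ^ p * ∫ ω, |Y ω| ^ p ∂P ≤ 16 * |l| ^ p * m :=
          mul_le_mul_of_nonneg_left hm (by positivity)
        linarith [Real.add_one_le_exp (16 * |l| ^ p * m)]

/-- The self-normalised exponential bound: no moment beyond the `p`-th is needed, because the
compensator `l² ∑ Y_i² / 2` grows with the summands. -/
lemma lintegral_exp_selfNormalized_le {P : Measure Ω} {Y : ℕ → Ω → ℝ}
    (hind : iIndepFun Y P) (hmeas : ∀ i, Measurable (Y i)) (hint : ∀ i, Integrable (Y i) P)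
    (hmean : ∀ i, ∫ ω, Y i ω ∂P = 0) {p m : ℝ} (hp : 1 ≤ p) (hp3 : p ≤ 3)
    (hYp : ∀ i, Integrable (fun ω => |Y i ω| ^ p) P) (hm : ∀ i, ∫ ω, |Y i ω| ^ p ∂P ≤ m)
    (n : ℕ) (l : ℝ) :
    ∫⁻ ω, ENNReal.ofReal (Real.exp (l * ∑ i ∈ Finset.range n, Y i ω -
      l ^ 2 * (∑ i ∈ Finset.range n, Y i ω ^ 2) / 2)) ∂P ≤
      ENNReal.ofReal (Real.exp (16 * (n * |l| ^ p) * m)) := by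
  have := hind.isProbabilityMeasure
  have hprod : ∀ ω, ENNReal.ofReal (Real.exp (l * ∑ i ∈ Finset.range n, Y i ω -
      l ^ 2 * (∑ i ∈ Finset.range n, Y i ω ^ 2) / 2)) =
      ∏ i ∈ Finset.range n, ENNReal.ofReal (Real.exp (l * Y i ω - l ^ 2 * Y i ω ^ 2 / 2)) := by
    intro ω
    rw [← ENNReal.ofReal_prod_of_nonneg fun _ _ => (Real.exp_pos _).le, ← Real.exp_sum,
      Finset.sum_sub_distrib, Finset.mul_sum, Finset.mul_sum, Finset.sum_div]
  simp_rw [hprod]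
  have hg : Measurable fun y : ℝ => ENNReal.ofReal (Real.exp (l * y - l ^ 2 * y ^ 2 / 2)) := by
    fun_prop
  rw [lintegral_prod_eq_prod_lintegral_of_indepFun (Finset.range n)
    (fun i ω => ENNReal.ofReal (Real.exp (l * Y i ω - l ^ 2 * Y i ω ^ 2 / 2)))
    (hind.comp (fun _ => _) fun _ => hg) fun i => hg.comp (hmeas i)]
  calc _ ≤ ∏ _i ∈ Finset.range n, ENNReal.ofReal (Real.exp (16 * |l| ^ p * m)) :=
        Finset.prod_le_prod' fun i _ =>
          lintegral_exp_sub_half_sq_le (hint i) (hmean i) hp hp3 (hYp i) (hm i) l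
    _ = _ := by
        rw [Finset.prod_const, Finset.card_range, ← ENNReal.ofReal_pow (Real.exp_pos _).le,
          ← Real.exp_nat_mul]
        ring_nf

/-! ### Tail bounds for the sum and the sum of squares -/

/-- Markov's inequality for the sum of squares, through its moment of order `q / 2`. -/
lemma measure_sum_sq_gt_le {P : Measure Ω} {Y : ℕ → Ω → ℝ}
    (hmeas : ∀ i, Measurable (Y i)) {q M : ℝ} (hq : 2 ≤ q)
    (hYq : ∀ i, Integrable (fun ω => |Y i ω| ^ q) P) (hM : ∀ i, ∫ ω, |Y i ω| ^ q ∂P ≤ M)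
    {n : ℕ} (hn : 1 ≤ n) :
    P {ω | (n : ℝ) ^ (3 / 2 : ℝ) < ∑ i ∈ Finset.range n, Y i ω ^ 2} ≤
      ENNReal.ofReal ((n : ℝ) ^ (-(q / 4)) * M) := by
  have hn' : (0 : ℝ) < n := by exact_mod_cast hn
  have hpt : ∀ ω, (∑ i ∈ Finset.range n, Y i ω ^ 2) ^ (q / 2) ≤
      (n : ℝ) ^ (q / 2 - 1) * ∑ i ∈ Finset.range n, |Y i ω| ^ q := by
    intro ω
    refine (Real.rpow_sum_le_const_mul_sum_rpow_of_nonneg (Finset.range n) (p := q / 2)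
      (by linarith) fun i _ => sq_nonneg (Y i ω)).trans (le_of_eq ?_)
    rw [Finset.card_range]
    congr 1
    refine Finset.sum_congr rfl fun i _ => ?_
    rw [← sq_abs, ← Real.rpow_natCast, ← Real.rpow_mul (abs_nonneg _)]
    congr 1
    push_cast
    ring
  have hmarkov : ENNReal.ofReal ((n : ℝ) ^ (3 / 4 * q)) *
      P {ω | ENNReal.ofReal ((n : ℝ) ^ (3 / 4 * q)) ≤
        ENNReal.ofReal ((n : ℝ) ^ (q / 2 - 1) * ∑ i ∈ Finset.range n, |Y i ω| ^ q)} ≤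
      ENNReal.ofReal ((n : ℝ) ^ (q / 2) * M) := by
    refine (mul_meas_ge_le_lintegral (by fun_prop) _).trans ?_
    rw [← ofReal_integral_eq_lintegral_ofReal
      ((integrable_finsetSum _ fun i _ => hYq i).const_mul _)
      (ae_of_all _ fun ω => by positivity), integral_const_mul,
      integral_finsetSum _ fun i _ => hYq i]
    refine ENNReal.ofReal_le_ofReal ?_
    calc _ ≤ (n : ℝ) ^ (q / 2 - 1) * (n * M) := by
          refine mul_le_mul_of_nonneg_left ?_ (by positivity)
          refine (Finset.sum_le_card_nsmul _ _ M fun i _ => hM i).trans (le_of_eq ?_)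
          rw [Finset.card_range, nsmul_eq_mul]
      _ = _ := by
          rw [← mul_assoc, Real.rpow_sub_one hn'.ne']
          field_simp
  have hsub : {ω | (n : ℝ) ^ (3 / 2 : ℝ) < ∑ i ∈ Finset.range n, Y i ω ^ 2} ⊆
      {ω | ENNReal.ofReal ((n : ℝ) ^ (3 / 4 * q)) ≤
        ENNReal.ofReal ((n : ℝ) ^ (q / 2 - 1) * ∑ i ∈ Finset.range n, |Y i ω| ^ q)} := by
    intro ω hω
    refine ENNReal.ofReal_le_ofReal (le_trans ?_ (hpt ω))
    have h := Real.rpow_le_rpow (by positivity) (le_of_lt hω) (by linarith : 0 ≤ q / 2)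
    rwa [← Real.rpow_mul hn'.le, show 3 / 2 * (q / 2) = 3 / 4 * q by ring] at h
  refine (measure_mono hsub).trans ?_
  have hsplit : (n : ℝ) ^ (q / 2) * M = (n : ℝ) ^ (3 / 4 * q) * ((n : ℝ) ^ (-(q / 4)) * M) := by
    rw [← mul_assoc, ← Real.rpow_add hn']
    ring_nf
  rw [hsplit, ENNReal.ofReal_mul (by positivity)] at hmarkov
  exact (ENNReal.mul_le_mul_iff_right (by positivity) ENNReal.ofReal_ne_top).1 hmarkov

/-- The sum is of order `n ^ 0.95` only with exponentially small probability while the sum of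
squares stays below `n ^ 1.5`. -/
lemma measure_sum_gt_le {P : Measure Ω} {Y : ℕ → Ω → ℝ}
    (hind : iIndepFun Y P) (hmeas : ∀ i, Measurable (Y i)) (hint : ∀ i, Integrable (Y i) P)
    (hmean : ∀ i, ∫ ω, Y i ω ∂P = 0) {p m : ℝ} (hp : 2 ≤ p) (hp3 : p ≤ 3)
    (hYp : ∀ i, Integrable (fun ω => |Y i ω| ^ p) P) (hm : ∀ i, ∫ ω, |Y i ω| ^ p ∂P ≤ m)
    (hm0 : 0 ≤ m) {n : ℕ} (hn : 1 ≤ n) {ε : ℝ} (hε : |ε| = 1) :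
    P {ω | (n : ℝ) ^ (0.95 : ℝ) < ε * ∑ i ∈ Finset.range n, Y i ω ∧
        ∑ i ∈ Finset.range n, Y i ω ^ 2 ≤ (n : ℝ) ^ (3 / 2 : ℝ)} ≤
      ENNReal.ofReal (Real.exp (16 * m + ((n : ℝ) ^ (0.3 : ℝ) / 2 - (n : ℝ) ^ (0.35 : ℝ)))) := by
  have hn' : (0 : ℝ) < n := by exact_mod_cast hn
  have hn1 : (1 : ℝ) ≤ n := by exact_mod_cast hn
  -- the exponent `-0.6` makes `l * n ^ 0.95` dominate `l² * n ^ 1.5`, while `n * l ^ p ≤ 1`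
  set l : ℝ := ε * (n : ℝ) ^ (-0.6 : ℝ) with hl
  have habs : |l| = (n : ℝ) ^ (-0.6 : ℝ) := by
    rw [hl, abs_mul, hε, one_mul, abs_of_pos (by positivity)]
  have hlsq : l ^ 2 = (n : ℝ) ^ (-1.2 : ℝ) := by
    rw [← sq_abs, habs, ← Real.rpow_natCast, ← Real.rpow_mul hn'.le]
    norm_num
  have hnl : n * |l| ^ p ≤ 1 := by
    rw [habs, ← Real.rpow_mul hn'.le, ← Real.rpow_one_add' hn'.le (by linarith)]
    exact Real.rpow_le_one_of_one_le_of_nonpos hn1 (by linarith)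
  set t := (n : ℝ) ^ (0.35 : ℝ) - (n : ℝ) ^ (0.3 : ℝ) / 2 with ht
  have hmarkov := (mul_meas_ge_le_lintegral (μ := P)
    (f := fun ω => ENNReal.ofReal (Real.exp (l * ∑ i ∈ Finset.range n, Y i ω -
      l ^ 2 * (∑ i ∈ Finset.range n, Y i ω ^ 2) / 2))) (by fun_prop)
      (ENNReal.ofReal (Real.exp t))).trans
    (lintegral_exp_selfNormalized_le hind hmeas hint hmean (by linarith) hp3 hYp hm n l)
  have hsub : {ω | (n : ℝ) ^ (0.95 : ℝ) < ε * ∑ i ∈ Finset.range n, Y i ω ∧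
        ∑ i ∈ Finset.range n, Y i ω ^ 2 ≤ (n : ℝ) ^ (3 / 2 : ℝ)} ⊆
      {ω | ENNReal.ofReal (Real.exp t) ≤
        ENNReal.ofReal (Real.exp (l * ∑ i ∈ Finset.range n, Y i ω -
          l ^ 2 * (∑ i ∈ Finset.range n, Y i ω ^ 2) / 2))} := by
    rintro ω ⟨h1, h2⟩
    refine ENNReal.ofReal_le_ofReal (Real.exp_le_exp.2 ?_)
    have h3 : (n : ℝ) ^ (-0.6 : ℝ) * (n : ℝ) ^ (0.95 : ℝ) = (n : ℝ) ^ (0.35 : ℝ) := by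
      rw [← Real.rpow_add hn']; norm_num
    have h4 : (n : ℝ) ^ (-1.2 : ℝ) * (n : ℝ) ^ (3 / 2 : ℝ) = (n : ℝ) ^ (0.3 : ℝ) := by
      rw [← Real.rpow_add hn']; norm_num
    have h5 : (n : ℝ) ^ (0.35 : ℝ) ≤ l * ∑ i ∈ Finset.range n, Y i ω := by
      rw [← h3, hl, mul_comm ε, mul_assoc]
      exact mul_le_mul_of_nonneg_left h1.le (by positivity)
    have h6 : l ^ 2 * (∑ i ∈ Finset.range n, Y i ω ^ 2) ≤ (n : ℝ) ^ (0.3 : ℝ) := by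
      rw [← h4, hlsq]
      exact mul_le_mul_of_nonneg_left h2 (by positivity)
    linarith
  refine (measure_mono hsub).trans ?_
  have hfin : ENNReal.ofReal (Real.exp (16 * (n * |l| ^ p) * m)) ≤
      ENNReal.ofReal (Real.exp t) *
        ENNReal.ofReal (Real.exp (16 * m + ((n : ℝ) ^ (0.3 : ℝ) / 2 - (n : ℝ) ^ (0.35 : ℝ)))) := by
    rw [← ENNReal.ofReal_mul (Real.exp_pos _).le, ← Real.exp_add]
    refine ENNReal.ofReal_le_ofReal (Real.exp_le_exp.2 ?_)
    nlinarith
  exact (ENNReal.mul_le_mul_iff_right (by simp [Real.exp_pos]) ENNReal.ofReal_ne_top).1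
    (hmarkov.trans hfin)

/-! ### Restricted exponential mixtures -/

/-- The mixture of `l ↦ exp (l s - l² u / 2)` over `[-Λ, Λ]` under Lebesgue measure. -/
noncomputable def restrictedMixture (Λ s u : ℝ) : ℝ≥0∞ :=
  ∫⁻ l in Set.Icc (-Λ) Λ, ENNReal.ofReal (Real.exp (l * s - l ^ 2 * u / 2))

lemma restrictedMixture_antitone (Λ s : ℝ) : Antitone (restrictedMixture Λ s) := by
  intro u v huv
  refine lintegral_mono fun l => ENNReal.ofReal_le_ofReal (Real.exp_le_exp.2 ?_)
  nlinarith [mul_le_mul_of_nonneg_left huv (sq_nonneg l)]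

lemma le_restrictedMixture_of_forall {Λ s u a b t : ℝ} (ha : -Λ ≤ a) (hb : b ≤ Λ)
    (h : ∀ l ∈ Set.Icc a b, t ≤ l * s - l ^ 2 * u / 2) :
    ENNReal.ofReal ((b - a) * Real.exp t) ≤ restrictedMixture Λ s u := by
  calc _ = ∫⁻ _l in Set.Icc a b, ENNReal.ofReal (Real.exp t) := by
        rw [setLIntegral_const, Real.volume_Icc, mul_comm (b - a),
          ENNReal.ofReal_mul (Real.exp_pos _).le]
    _ ≤ ∫⁻ l in Set.Icc a b, ENNReal.ofReal (Real.exp (l * s - l ^ 2 * u / 2)) :=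
        setLIntegral_mono (by fun_prop) fun l hl =>
          ENNReal.ofReal_le_ofReal (Real.exp_le_exp.2 (h l hl))
    _ ≤ _ := lintegral_mono_set (Set.Icc_subset_Icc ha hb)

/-- The restricted mixture dominates the unrestricted one (up to a constant) when the maximiser
`s / u` of the exponent lies in `[-Λ, Λ]`, and is at least exponential in `Λ² u` otherwise. -/
lemma min_le_restrictedMixture {Λ u : ℝ} (hΛ : 0 < Λ) (hu : 0 < u) (hΛu : 1 ≤ Λ ^ 2 * u) (s : ℝ) :
    ENNReal.ofReal (min (Real.exp (s ^ 2 / (2 * u) - 1 / 2) / Real.sqrt u)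
      (Λ / 2 * Real.exp (Λ ^ 2 * u / 8))) ≤ restrictedMixture Λ s u := by
  wlog hs : 0 ≤ s generalizing s with H
  · have h1 := H (-s) (by linarith)
    have h2 : restrictedMixture Λ (-s) u = restrictedMixture Λ s u := by
      unfold restrictedMixture
      rw [← (Measure.measurePreserving_neg (volume : Measure ℝ)).setLIntegral_comp_preimage
        measurableSet_Icc (by fun_prop)]
      simp
    rwa [h2, neg_sq] at h1
  have hsu : 0 < Real.sqrt u := Real.sqrt_pos.2 hu
  have hsq : Real.sqrt u ^ 2 = u := Real.sq_sqrt hu.le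
  set h := 1 / Real.sqrt u with hh
  have hh0 : 0 < h := by positivity
  have hhu : h ^ 2 * u = 1 := by rw [hh, div_pow, hsq]; field_simp
  have hhΛ : h ≤ Λ := by
    rw [hh, div_le_iff₀ hsu]
    refine le_of_sq_le_sq ?_ (by positivity)
    rw [mul_pow, hsq]; linarith
  rcases le_total (s / u) Λ with hc | hc
  · -- on `[s / u - 1 / √u, s / u]` the exponent is within `1 / 2` of its maximum
    refine (ENNReal.ofReal_le_ofReal (min_le_left _ _)).trans ?_
    have hsu0 : 0 ≤ s / u := by positivity
    refine le_trans (le_of_eq ?_) (le_restrictedMixture_of_forall (a := s / u - h) (b := s / u)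
      (t := s ^ 2 / (2 * u) - 1 / 2) (by linarith) hc ?_)
    · rw [sub_sub_cancel, hh]; ring_nf
    · rintro l ⟨hl1, hl2⟩
      have h1 : l * s - l ^ 2 * u / 2 = s ^ 2 / (2 * u) - (s / u - l) ^ 2 * u / 2 := by
        field_simp; ring
      have h2 : (s / u - l) ^ 2 ≤ h ^ 2 := pow_le_pow_left₀ (by linarith) (by linarith) 2
      nlinarith [mul_le_mul_of_nonneg_right h2 hu.le]
  · refine (ENNReal.ofReal_le_ofReal (min_le_right _ _)).trans ?_
    refine le_trans (le_of_eq ?_) (le_restrictedMixture_of_forall (a := Λ / 2) (b := Λ)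
      (t := Λ ^ 2 * u / 8) (by linarith) le_rfl ?_)
    · ring_nf
    · rintro l ⟨hl1, hl2⟩
      have h1 : Λ * u ≤ s := (le_div_iff₀ hu).1 hc
      have h2 : l * (l * u) ≤ l * s :=
        mul_le_mul_of_nonneg_left ((mul_le_mul_of_nonneg_right hl2 hu.le).trans h1) (by linarith)
      have h3 : (Λ / 2) ^ 2 ≤ l ^ 2 := pow_le_pow_left₀ (by linarith) hl1 2
      nlinarith [mul_le_mul_of_nonneg_right h3 hu.le]

lemma lintegral_restrictedMixture_le {P : Measure Ω} {Y : ℕ → Ω → ℝ}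
    (hind : iIndepFun Y P) (hmeas : ∀ i, Measurable (Y i)) (hint : ∀ i, Integrable (Y i) P)
    (hmean : ∀ i, ∫ ω, Y i ω ∂P = 0) {p m : ℝ} (hp : 1 ≤ p) (hp3 : p ≤ 3)
    (hYp : ∀ i, Integrable (fun ω => |Y i ω| ^ p) P) (hm : ∀ i, ∫ ω, |Y i ω| ^ p ∂P ≤ m)
    (hm0 : 0 ≤ m) {n : ℕ} {Λ : ℝ} (hnΛ : n * Λ ^ p ≤ 1) :
    ∫⁻ ω, restrictedMixture Λ (∑ i ∈ Finset.range n, Y i ω)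
      (∑ i ∈ Finset.range n, Y i ω ^ 2) ∂P ≤ ENNReal.ofReal (2 * Λ * Real.exp (16 * m)) := by
  have := hind.isProbabilityMeasure
  unfold restrictedMixture
  rw [lintegral_lintegral_swap (by fun_prop)]
  calc _ ≤ ∫⁻ _l in Set.Icc (-Λ) Λ, ENNReal.ofReal (Real.exp (16 * m)) := by
        refine setLIntegral_mono (by fun_prop) fun l hl => ?_
        refine (lintegral_exp_selfNormalized_le hind hmeas hint hmean hp hp3 hYp hm n l).trans ?_
        refine ENNReal.ofReal_le_ofReal (Real.exp_le_exp.2 ?_)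
        have h1 : n * |l| ^ p ≤ 1 := le_trans (mul_le_mul_of_nonneg_left
          (Real.rpow_le_rpow (abs_nonneg l) (abs_le.2 hl) (by linarith)) (by positivity)) hnΛ
        nlinarith
    _ = _ := by
        rw [setLIntegral_const, Real.volume_Icc, mul_comm (2 * Λ),
          ENNReal.ofReal_mul (Real.exp_pos _).le]
        ring_nf

/-! ### Growth rates -/

lemma tendsto_rpow_mul_exp_neg_rpow (s : ℝ) {b r : ℝ} (hb : 0 < b) (hr : 0 < r) :
    Tendsto (fun n : ℕ => (n : ℝ) ^ s * Real.exp (-b * (n : ℝ) ^ r)) atTop (nhds 0) := by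
  have h := (tendsto_rpow_mul_exp_neg_mul_atTop_nhds_zero (s / r) b hb).comp
    ((tendsto_rpow_atTop hr).comp tendsto_natCast_atTop_atTop)
  refine h.congr fun n => ?_
  simp only [Function.comp]
  rw [← Real.rpow_mul (Nat.cast_nonneg n), mul_div_cancel₀ _ hr.ne']

lemma eventually_rpow_one_sub_le_div_log {b : ℝ} (hb : 0 < b) :
    ∀ᶠ n : ℕ in atTop, (n : ℝ) ^ (1 - b) ≤ n / Real.log n := by
  have h := tendsto_natCast_atTop_atTop.eventually
    ((isLittleO_log_rpow_atTop hb).bound (zero_lt_one' ℝ))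
  filter_upwards [h, eventually_ge_atTop 2] with n hn hn2
  have hn1 : (1 : ℝ) < n := by exact_mod_cast hn2
  have hn0 : (0 : ℝ) < n := by linarith
  have hlog := Real.log_pos hn1
  rw [one_mul, Real.norm_of_nonneg hlog.le, Real.norm_of_nonneg (by positivity)] at hn
  rw [Real.rpow_sub hn0, Real.rpow_one]
  gcongr

/-! ### The risk bound -/

/-- The cut-off of the mixture. With `a = p - 2 ∈ (0, 1]` it is large compared with the scale
`n ^ (-1/2)` of the relevant values of `l`, and yet `n Λ ^ p ≤ 1`. -/
noncomputable def mixtureCutoff (a : ℝ) (n : ℕ) : ℝ := (n : ℝ) ^ (-(1 / 2 - a / 6))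

lemma mixtureCutoff_pos (a : ℝ) {n : ℕ} (hn : 1 ≤ n) : 0 < mixtureCutoff a n := by
  have hn' : (0 : ℝ) < n := by exact_mod_cast hn
  unfold mixtureCutoff
  positivity

lemma mul_mixtureCutoff_rpow_le {a : ℝ} (ha : 0 < a) (ha1 : a ≤ 1) {n : ℕ} (hn : 1 ≤ n) :
    n * mixtureCutoff a n ^ (2 + a) ≤ 1 := by
  have hn' : (0 : ℝ) < n := by exact_mod_cast hn
  unfold mixtureCutoff
  rw [← Real.rpow_mul hn'.le, mul_comm, ← Real.rpow_add_one hn'.ne']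
  exact Real.rpow_le_one_of_one_le_of_nonpos (by exact_mod_cast hn) (by nlinarith)

lemma rpow_le_mixtureCutoff_sq_mul {a u : ℝ} {n : ℕ} (hn : 1 ≤ n)
    (hu : (n : ℝ) ^ (1 - a / 6) ≤ u) : (n : ℝ) ^ (a / 6) ≤ mixtureCutoff a n ^ 2 * u := by
  have hn' : (0 : ℝ) < n := by exact_mod_cast hn
  calc (n : ℝ) ^ (a / 6) = mixtureCutoff a n ^ 2 * (n : ℝ) ^ (1 - a / 6) := by
        unfold mixtureCutoff
        rw [← Real.rpow_natCast, ← Real.rpow_mul hn'.le, ← Real.rpow_add hn']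
        congr 1
        push_cast
        ring
    _ ≤ _ := by gcongr

/-- The capped e-value is dominated by the restricted mixture. -/
lemma min_mixtureEValue_le {ρ c Λ u v : ℝ} (hρ : 0 < ρ) (hΛ : 0 < Λ) (hu : 0 < u) (hv : 1 ≤ v)
    (hvu : v ≤ Λ ^ 2 * u)
    (hc : c ≤ Real.exp (1 / 2) / Real.sqrt ρ * (Λ / 2 * Real.exp (v / 8)))
    (n : ℕ) (x θ : ℝ) :
    ENNReal.ofReal (min (mixtureEValue ρ n u x θ) c) ≤
      ENNReal.ofReal (Real.exp (1 / 2) / Real.sqrt ρ) *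
        restrictedMixture Λ (n * (x - θ)) u := by
  have hsρ : 0 < Real.sqrt ρ := Real.sqrt_pos.2 hρ
  have hsu : 0 < Real.sqrt u := Real.sqrt_pos.2 hu
  refine le_trans ?_ (mul_le_mul_right
    (min_le_restrictedMixture hΛ hu (hv.trans hvu) (n * (x - θ))) _)
  rw [← ENNReal.ofReal_mul (by positivity), mul_min_of_nonneg _ _ (by positivity)]
  refine ENNReal.ofReal_le_ofReal (min_le_min ?_ (hc.trans ?_))
  · unfold mixtureEValue
    have h1 : Real.sqrt ρ * Real.sqrt u ≤ Real.sqrt (ρ * u + 1) := by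
      rw [← Real.sqrt_mul hρ.le]
      exact Real.sqrt_le_sqrt (by linarith)
    have h2 : (n : ℝ) ^ 2 * ρ * (θ - x) ^ 2 / (2 * ρ * u + 2) ≤
        (n * (x - θ)) ^ 2 / (2 * u) := by
      rw [div_le_div_iff₀ (by positivity) (by positivity)]
      nlinarith [sq_nonneg (n * (x - θ))]
    calc _ ≤ Real.exp ((n * (x - θ)) ^ 2 / (2 * u)) / (Real.sqrt ρ * Real.sqrt u) := by
          gcongr
      _ = _ := by
          rw [Real.exp_sub]
          field_simp
  · gcongr

/-- The explicit bound on the risk of the `n`-th interval when the centred `(2 + δ)`-th moment is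
at most `M`: the mean of the restricted mixture, plus the cap times the probability that `û_n`
falls below the centred sum of squares. -/
noncomputable def riskBound (δ C ρ M : ℝ) (n : ℕ) : ℝ :=
  Real.exp (1 / 2) / Real.sqrt ρ *
      (2 * mixtureCutoff (min δ 1) n * Real.exp (16 * (1 + M))) +
    C * (n : ℝ) ^ (0.24 * δ) * ((n : ℝ) ^ (-((2 + δ) / 4)) * M +
      2 * Real.exp (16 * (1 + M) + ((n : ℝ) ^ (0.3 : ℝ) / 2 - (n : ℝ) ^ (0.35 : ℝ))))

lemma tendsto_riskBound {δ C ρ M : ℝ} (hδ : 0 < δ) :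
    Tendsto (riskBound δ C ρ M) atTop (nhds 0) := by
  have h1 : Tendsto (mixtureCutoff (min δ 1)) atTop (nhds 0) :=
    (tendsto_rpow_neg_atTop (by linarith [min_le_right δ 1])).comp tendsto_natCast_atTop_atTop
  -- `0.24 δ < (2 + δ) / 4`, so the moment term survives multiplication by the cap
  have h2 : Tendsto (fun n : ℕ => (n : ℝ) ^ (0.24 * δ) * (n : ℝ) ^ (-((2 + δ) / 4)))
      atTop (nhds 0) := by
    refine ((tendsto_rpow_neg_atTop (by linarith : 0 < (2 + δ) / 4 - 0.24 * δ)).comp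
      tendsto_natCast_atTop_atTop).congr' ?_
    filter_upwards [eventually_ge_atTop 1] with n hn
    have hn' : (0 : ℝ) < n := by exact_mod_cast hn
    simp only [Function.comp]
    rw [← Real.rpow_add hn']
    ring_nf
  have h3 : Tendsto (fun n : ℕ => (n : ℝ) ^ (0.24 * δ) *
      Real.exp ((n : ℝ) ^ (0.3 : ℝ) / 2 - (n : ℝ) ^ (0.35 : ℝ))) atTop (nhds 0) := by
    refine squeeze_zero' (Eventually.of_forall fun n => by positivity) ?_
      (tendsto_rpow_mul_exp_neg_rpow (0.24 * δ) (b := 1 / 2) (r := 0.35) (by norm_num)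
        (by norm_num))
    filter_upwards [eventually_ge_atTop 1] with n hn
    have h : (n : ℝ) ^ (0.3 : ℝ) ≤ (n : ℝ) ^ (0.35 : ℝ) :=
      Real.rpow_le_rpow_of_exponent_le (by exact_mod_cast hn) (by norm_num)
    gcongr
    linarith
  have h := (h1.const_mul (Real.exp (1 / 2) / Real.sqrt ρ * (2 * Real.exp (16 * (1 + M))))).add
    ((h2.const_mul (C * M)).add (h3.const_mul (C * 2 * Real.exp (16 * (1 + M)))))
  simp only [mul_zero, add_zero] at h
  refine h.congr fun n => ?_
  unfold riskBound
  rw [Real.exp_add]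
  ring

/-- The conditions on `n` under which `riskBound` is valid. They do not involve the underlying
measure, which is what makes the bound uniform. -/
structure IsLargeIndex (δ C ρ : ℝ) (n : ℕ) : Prop where
  two_le : 2 ≤ n
  rpow_le : (n : ℝ) ^ (1 - min δ 1 / 6) ≤ n / Real.log n
  rpow_le' : (n : ℝ) ^ (1 - 0.1 : ℝ) ≤ n / Real.log n
  cap_le : C * (n : ℝ) ^ (0.24 * δ) ≤ Real.exp (1 / 2) / Real.sqrt ρ *
    (mixtureCutoff (min δ 1) n / 2 * Real.exp ((n : ℝ) ^ (min δ 1 / 6) / 8))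

lemma eventually_isLargeIndex {δ C ρ : ℝ} (hδ : 0 < δ) (hρ : 0 < ρ) :
    ∀ᶠ n : ℕ in atTop, IsLargeIndex δ C ρ n := by
  have ha : 0 < min δ 1 / 6 := by positivity
  set a := min δ 1 with ha_def
  have hB : 0 < Real.exp (1 / 2) / Real.sqrt ρ := by positivity
  have h := ((tendsto_rpow_mul_exp_neg_rpow (0.24 * δ + (1 / 2 - a / 6)) (b := 1 / 8)
    (by norm_num) ha).const_mul C).eventually_le_const
    (show C * 0 < Real.exp (1 / 2) / Real.sqrt ρ / 2 by rw [mul_zero]; positivity)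
  filter_upwards [h, eventually_ge_atTop 2, eventually_rpow_one_sub_le_div_log ha,
    eventually_rpow_one_sub_le_div_log (b := 0.1) (by norm_num)] with n h1 h2 h3 h4
  refine ⟨h2, h3, h4, ?_⟩
  have hn' : (0 : ℝ) < n := by positivity
  have hE := Real.exp_pos ((n : ℝ) ^ (a / 6) / 8)
  have hL : 0 < mixtureCutoff a n := mixtureCutoff_pos a (by linarith)
  have e1 : (n : ℝ) ^ (0.24 * δ + (1 / 2 - a / 6)) * mixtureCutoff a n =
      (n : ℝ) ^ (0.24 * δ) := by
    unfold mixtureCutoff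
    rw [← Real.rpow_add hn']
    ring_nf
  have e2 : Real.exp (-(1 / 8) * (n : ℝ) ^ (a / 6)) * Real.exp ((n : ℝ) ^ (a / 6) / 8) = 1 := by
    rw [← Real.exp_add, Real.exp_eq_one_iff]
    ring
  calc C * (n : ℝ) ^ (0.24 * δ)
      = C * ((n : ℝ) ^ (0.24 * δ + (1 / 2 - a / 6)) * Real.exp (-(1 / 8) * (n : ℝ) ^ (a / 6))) *
          (mixtureCutoff a n * Real.exp ((n : ℝ) ^ (a / 6) / 8)) := by
        rw [← e1]
        linear_combination (-C * (n : ℝ) ^ (0.24 * δ + (1 / 2 - a / 6)) * mixtureCutoff a n) * e2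
    _ ≤ Real.exp (1 / 2) / Real.sqrt ρ / 2 *
          (mixtureCutoff a n * Real.exp ((n : ℝ) ^ (a / 6) / 8)) := by gcongr
    _ = _ := by ring

/-- The non-asymptotic form of the theorem: the risk bound is uniform over all laws whose centred
`(2 + δ)`-th moment is at most `M`. -/
lemma postHocRisk_rwsInterval_le {X : ℕ → Ω → ℝ} {δ C ρ M θ : ℝ} (hδ : 0 < δ) (hC : 0 < C)
    (hρ : 0 < ρ) {P : Measure Ω} (hind : iIndepFun (fun i ω => X i ω - θ) P)
    (hX : ∀ i, Measurable (X i)) (hint : ∀ i, Integrable (fun ω => X i ω - θ) P)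
    (hmean : ∀ i, ∫ ω, (X i ω - θ) ∂P = 0)
    (hXq : ∀ i, Integrable (fun ω => |X i ω - θ| ^ (2 + δ)) P)
    (hM : ∀ i, ∫ ω, |X i ω - θ| ^ (2 + δ) ∂P ≤ M) {n : ℕ} (hn : IsLargeIndex δ C ρ n) :
    postHocRisk (rwsInterval X δ C ρ n) θ P ≤ ENNReal.ofReal (riskBound δ C ρ M n) := by
  have := hind.isProbabilityMeasure
  obtain ⟨hn2, hlog1, hlog2, hcap⟩ := hn
  have hn1 : 1 ≤ n := by linarith
  have hn' : (0 : ℝ) < n := by exact_mod_cast hn1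
  set a := min δ 1 with ha_def
  have ha : 0 < a := by positivity
  have ha1 : a ≤ 1 := min_le_right _ _
  have haδ : a ≤ δ := min_le_left _ _
  set Λ := mixtureCutoff a n with hΛ_def
  have hΛ : 0 < Λ := mixtureCutoff_pos a hn1
  set B := Real.exp (1 / 2) / Real.sqrt ρ with hB_def
  have hB : 0 ≤ B := by positivity
  set c := C * (n : ℝ) ^ (0.24 * δ) with hc_def
  have hc : 0 ≤ c := by positivity
  have hM0 : 0 ≤ M := le_trans (integral_nonneg fun ω => by positivity) (hM 0)
  have hmeas : ∀ i, Measurable fun ω => X i ω - θ := fun i => (hX i).sub_const θ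
  -- the moment of order `2 + a ≤ 3` is controlled by that of order `2 + δ`
  have hpq : ∀ i ω, |X i ω - θ| ^ (2 + a) ≤ 1 + |X i ω - θ| ^ (2 + δ) := by
    intro i ω
    rcases le_total |X i ω - θ| 1 with h | h
    · have h1 := Real.rpow_le_one (abs_nonneg (X i ω - θ)) h (by linarith : 0 ≤ 2 + a)
      have h2 : 0 ≤ |X i ω - θ| ^ (2 + δ) := by positivity
      linarith
    · have h1 := Real.rpow_le_rpow_of_exponent_le h (by linarith : 2 + a ≤ 2 + δ)
      linarith
  have hXp : ∀ i, Integrable (fun ω => |X i ω - θ| ^ (2 + a)) P := fun i => by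
    refine ((integrable_const (1 : ℝ)).add (hXq i)).mono' ?_ (ae_of_all _ fun ω => ?_)
    · have := hmeas i
      exact Measurable.aestronglyMeasurable (by fun_prop)
    · rw [Real.norm_of_nonneg (by positivity)]
      exact hpq i ω
  have hm : ∀ i, ∫ ω, |X i ω - θ| ^ (2 + a) ∂P ≤ 1 + M := fun i => by
    calc _ ≤ ∫ ω, (1 + |X i ω - θ| ^ (2 + δ)) ∂P :=
          integral_mono (hXp i) ((integrable_const _).add (hXq i)) (hpq i)
      _ ≤ 1 + M := by
          rw [integral_add (integrable_const _) (hXq i)]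
          simpa using hM i
  set S : Ω → ℝ := fun ω => ∑ i ∈ Finset.range n, (X i ω - θ) with hS
  set V : Ω → ℝ := fun ω => ∑ i ∈ Finset.range n, (X i ω - θ) ^ 2 with hV
  have hSm : Measurable S := by fun_prop
  have hVm : Measurable V := by fun_prop
  set bad : Set Ω := {ω | (n : ℝ) ^ (0.95 : ℝ) < |S ω|} with hbad
  have hbadm : MeasurableSet bad := measurableSet_lt measurable_const (by fun_prop)
  have hpt : ∀ ω, postHocLoss (rwsInterval X δ C ρ n ω) θ ≤
      ENNReal.ofReal B * restrictedMixture Λ (S ω) (V ω) +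
        bad.indicator (fun _ => ENNReal.ofReal c) ω := by
    intro ω
    rw [postHocLoss_rwsInterval X hC hρ hn1]
    by_cases hω : ω ∈ bad
    · rw [Set.indicator_of_mem hω]
      exact (ENNReal.ofReal_le_ofReal (min_le_right _ _)).trans le_add_self
    · rw [Set.indicator_of_notMem hω, add_zero]
      have hSle : |S ω| ≤ (n : ℝ) ^ (0.95 : ℝ) := not_lt.1 hω
      have hu1 : (n : ℝ) / Real.log n ≤ uHat X n ω := by
        have := biasedSampleVar_nonneg X n ω
        unfold uHat
        rw [mul_add, mul_one_div]
        have : 0 ≤ (n : ℝ) * biasedSampleVar X n ω := by positivity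
        linarith
      have hu : 0 < uHat X n ω :=
        lt_of_lt_of_le (by positivity) (hlog1.trans hu1)
      have hVu : V ω ≤ uHat X n ω := by
        rw [uHat_eq X hn1 ω θ]
        have h1 : S ω ^ 2 / n ≤ n / Real.log n := by
          refine le_trans ?_ hlog2
          rw [div_le_iff₀ hn', ← Real.rpow_add_one hn'.ne', ← sq_abs]
          refine (pow_le_pow_left₀ (abs_nonneg _) hSle 2).trans (le_of_eq ?_)
          rw [← Real.rpow_natCast, ← Real.rpow_mul hn'.le]
          norm_num
        have h2 : (∑ i ∈ Finset.range n, (X i ω - θ)) = S ω := rfl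
        have h3 : (∑ i ∈ Finset.range n, (X i ω - θ) ^ 2) = V ω := rfl
        rw [h2, h3]
        linarith
      have h1 := min_mixtureEValue_le (c := c) hρ hΛ hu
        (Real.one_le_rpow (by exact_mod_cast hn1) (by positivity))
        (rpow_le_mixtureCutoff_sq_mul hn1 (hlog1.trans hu1)) hcap n (sampleMean X n ω) θ
      rw [mul_sub_sampleMean X hn1 ω θ] at h1
      exact h1.trans (mul_le_mul_right (restrictedMixture_antitone Λ _ hVu) _)
  have hbadP : P bad ≤ ENNReal.ofReal ((n : ℝ) ^ (-((2 + δ) / 4)) * M +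
      2 * Real.exp (16 * (1 + M) + ((n : ℝ) ^ (0.3 : ℝ) / 2 - (n : ℝ) ^ (0.35 : ℝ)))) := by
    have h0 := measure_sum_sq_gt_le hmeas (by linarith : 2 ≤ 2 + δ) hXq hM hn1
    have h1 := measure_sum_gt_le hind hmeas hint hmean (by linarith) (by linarith) hXp hm
      (by linarith) hn1 (ε := 1) (by simp)
    have h2 := measure_sum_gt_le hind hmeas hint hmean (by linarith) (by linarith) hXp hm
      (by linarith) hn1 (ε := -1) (by simp)
    have hsub : bad ⊆ {ω | (n : ℝ) ^ (3 / 2 : ℝ) < V ω} ∪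
        ({ω | (n : ℝ) ^ (0.95 : ℝ) < 1 * S ω ∧ V ω ≤ (n : ℝ) ^ (3 / 2 : ℝ)} ∪
          {ω | (n : ℝ) ^ (0.95 : ℝ) < -1 * S ω ∧ V ω ≤ (n : ℝ) ^ (3 / 2 : ℝ)}) := by
      intro ω hω
      rcases lt_or_ge ((n : ℝ) ^ (3 / 2 : ℝ)) (V ω) with h | h
      · exact Or.inl h
      · rcases lt_abs.1 (show (n : ℝ) ^ (0.95 : ℝ) < |S ω| from hω) with h' | h'
        · exact Or.inr (Or.inl ⟨by linarith, h⟩)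
        · exact Or.inr (Or.inr ⟨by linarith, h⟩)
    refine (measure_mono hsub).trans ((measure_union_le _ _).trans ?_)
    rw [ENNReal.ofReal_add (by positivity) (by positivity), two_mul,
      ENNReal.ofReal_add (by positivity) (by positivity)]
    exact add_le_add h0 ((measure_union_le _ _).trans (add_le_add h1 h2))
  unfold postHocRisk
  calc _ ≤ ∫⁻ ω, (ENNReal.ofReal B * restrictedMixture Λ (S ω) (V ω) +
        bad.indicator (fun _ => ENNReal.ofReal c) ω) ∂P := lintegral_mono hpt
    _ = ENNReal.ofReal B * ∫⁻ ω, restrictedMixture Λ (S ω) (V ω) ∂P +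
          ENNReal.ofReal c * P bad := by
        rw [lintegral_add_right _ (measurable_const.indicator hbadm),
          lintegral_const_mul' _ _ ENNReal.ofReal_ne_top, lintegral_indicator_const hbadm]
    _ ≤ ENNReal.ofReal B * ENNReal.ofReal (2 * Λ * Real.exp (16 * (1 + M))) +
          ENNReal.ofReal c * ENNReal.ofReal ((n : ℝ) ^ (-((2 + δ) / 4)) * M +
      2 * Real.exp (16 * (1 + M) + ((n : ℝ) ^ (0.3 : ℝ) / 2 - (n : ℝ) ^ (0.35 : ℝ)))) := by
        gcongr
        exact lintegral_restrictedMixture_le hind hmeas hint hmean (by linarith) (by linarith)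
          hXp hm (by linarith) (mul_mixtureCutoff_rpow_le ha ha1 hn1)
    _ = _ := by
        rw [← ENNReal.ofReal_mul hB, ← ENNReal.ofReal_mul hc,
          ← ENNReal.ofReal_add (by positivity) (by positivity)]
        rfl

/-! ### Moment classes and uniformity -/

/-- The risk bound for iid observations, with the moment hypothesis on the first one only. -/
lemma postHocRisk_rwsInterval_le_of_isIID {X : ℕ → Ω → ℝ} {δ C ρ M θ : ℝ} (hδ : 0 < δ)
    (hC : 0 < C) (hρ : 0 < ρ) {P : Measure Ω} (hiid : IsIID X P)
    (hlaw : P.map (X 0) ∈ momentClass (2 + δ) θ) (hM : ∫ ω, |X 0 ω - θ| ^ (2 + δ) ∂P ≤ M)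
    {n : ℕ} (hn : IsLargeIndex δ C ρ n) :
    postHocRisk (rwsInterval X δ C ρ n) θ P ≤ ENNReal.ofReal (riskBound δ C ρ M n) := by
  obtain ⟨hP, hX, hind, hid⟩ := hiid
  obtain ⟨-, h1, h2, h3⟩ := hlaw
  have hX0 := (hX 0).aemeasurable (μ := P)
  have hint0 : Integrable (X 0) P := (integrable_map_measure (by fun_prop) hX0).1 h1
  have hmean0 : ∫ ω, X 0 ω ∂P = θ := by
    rw [← h2, integral_map hX0 (by fun_prop)]
  have hq0 : Integrable (fun ω => |X 0 ω - θ| ^ (2 + δ)) P :=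
    (integrable_map_measure (Measurable.aestronglyMeasurable (by fun_prop)) hX0).1 h3
  have hg : Measurable fun y : ℝ => |y - θ| ^ (2 + δ) := by fun_prop
  have hint : ∀ i, Integrable (X i) P := fun i => (hid i).integrable_iff.2 hint0
  refine postHocRisk_rwsInterval_le hδ hC hρ
    (hind.comp (fun _ y => y - θ) fun _ => by fun_prop) hX
    (fun i => (hint i).sub (integrable_const θ)) (fun i => ?_)
    (fun i => ((hid i).comp hg).integrable_iff.2 hq0)
    (fun i => le_trans (le_of_eq ((hid i).comp hg).integral_eq) hM) hn
  rw [integral_sub (hint i) (integrable_const θ), (hid i).integral_eq, hmean0]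
  simp

/-- The centred moment is bounded in terms of the raw one. -/
lemma integral_abs_sub_rpow_le {P : Measure Ω} [IsProbabilityMeasure P] {Y : Ω → ℝ} {q θ : ℝ}
    (hq : 1 ≤ q) (hY : Measurable Y) (hint : Integrable Y P) (hmean : ∫ ω, Y ω ∂P = θ)
    {R : ℝ} (hR : 0 ≤ R) (hYq : ∫⁻ ω, ENNReal.ofReal (|Y ω| ^ q) ∂P ≤ ENNReal.ofReal R) :
    ∫ ω, |Y ω - θ| ^ q ∂P ≤ 2 ^ (q - 1) * (R + (1 + R) ^ q) := by
  have hi : Integrable (fun ω => |Y ω| ^ q) P := by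
    refine ⟨Measurable.aestronglyMeasurable (by fun_prop), ?_⟩
    rw [hasFiniteIntegral_iff_ofReal (ae_of_all _ fun ω => by positivity)]
    exact hYq.trans_lt ENNReal.ofReal_lt_top
  have hR' : ∫ ω, |Y ω| ^ q ∂P ≤ R := by
    rw [← ofReal_integral_eq_lintegral_ofReal hi (ae_of_all _ fun ω => by positivity)] at hYq
    exact (ENNReal.ofReal_le_ofReal_iff hR).1 hYq
  have hθ : |θ| ≤ 1 + R := by
    calc |θ| ≤ ∫ ω, |Y ω| ∂P := by rw [← hmean]; exact abs_integral_le_integral_abs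
      _ ≤ ∫ ω, (1 + |Y ω| ^ q) ∂P := by
          refine integral_mono hint.abs ((integrable_const _).add hi) fun ω => ?_
          have h0 : 0 ≤ |Y ω| ^ q := by positivity
          rcases le_total |Y ω| 1 with h | h
          · simp only; linarith
          · have := Real.rpow_le_rpow_of_exponent_le h hq
            rw [Real.rpow_one] at this
            simp only; linarith
      _ ≤ 1 + R := by
          rw [integral_add (integrable_const _) hi]
          simpa using hR'
  have hpt : ∀ ω, |Y ω - θ| ^ q ≤ 2 ^ (q - 1) * (|Y ω| ^ q + (1 + R) ^ q) := by
    intro ω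
    calc |Y ω - θ| ^ q ≤ (|Y ω| + |θ|) ^ q := by
          gcongr
          exact abs_sub _ _
      _ ≤ 2 ^ (q - 1) * (|Y ω| ^ q + |θ| ^ q) :=
          by
          exact_mod_cast NNReal.rpow_add_le_mul_rpow_add_rpow ⟨|Y ω|, abs_nonneg _⟩
            ⟨|θ|, abs_nonneg _⟩ hq
      _ ≤ _ := by gcongr
  have hi' : Integrable (fun ω => 2 ^ (q - 1) * (|Y ω| ^ q + (1 + R) ^ q)) P :=
    (hi.add (integrable_const _)).const_mul _
  calc _ ≤ ∫ ω, 2 ^ (q - 1) * (|Y ω| ^ q + (1 + R) ^ q) ∂P :=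
        integral_mono_of_nonneg (ae_of_all _ fun ω => by positivity) hi' (ae_of_all _ hpt)
    _ ≤ _ := by
        rw [integral_const_mul, integral_add hi (integrable_const _)]
        simp only [integral_const, probReal_univ, smul_eq_mul, one_mul]
        gcongr

end

theorem theorem5 {Ω : Type*} [MeasurableSpace Ω] (X : ℕ → Ω → ℝ)
    (δ C ρ : ℝ) (hδ : 0 < δ) (hC : 0 < C) (hρ : 0 < ρ)
    (𝔓 : Set (Measure Ω)) (μ : Measure Ω → ℝ)
    (hiid : ∀ P ∈ 𝔓, IsIID X P)
    (hlaw : ∀ P ∈ 𝔓, P.map (X 0) ∈ momentClass (2 + δ) (μ P)) :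
    IsAsympPostHocCI (rwsInterval X δ C ρ) μ 𝔓 ∧
      (HasUniformlyBoundedMoment X (2 + δ) 𝔓 →
        IsUniformAsympPostHocCI (rwsInterval X δ C ρ) μ 𝔓) := by
  have hmeas : ∀ n, 1 ≤ n → ∀ P ∈ 𝔓,
      AEMeasurable (fun ω => postHocLoss (rwsInterval X δ C ρ n ω) (μ P)) P := fun n hn P hP =>
    (measurable_postHocLoss_rwsInterval (hiid P hP).measurable hC hρ hn (μ P)).aemeasurable
  have hlim : ∀ M, Tendsto (fun n => ENNReal.ofReal (riskBound δ C ρ M n)) atTop (nhds 0) :=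
    fun M => by simpa using ENNReal.tendsto_ofReal (tendsto_riskBound (C := C) (ρ := ρ) (M := M) hδ)
  have hlarge := eventually_isLargeIndex (C := C) hδ hρ
  refine ⟨⟨hmeas, iSup₂_le fun P hP => ?_⟩, fun hB => ⟨hmeas, ?_⟩⟩
  · refine (limsup_le_limsup (hlarge.mono fun n hn => ?_)).trans
      ((hlim (∫ ω, |X 0 ω - μ P| ^ (2 + δ) ∂P)).limsup_eq.le.trans zero_le_one)
    exact postHocRisk_rwsInterval_le_of_isIID hδ hC hρ (hiid P hP) (hlaw P hP) le_rfl hn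
  · set R := (⨆ P ∈ 𝔓, ∫⁻ ω, ENNReal.ofReal (|X 0 ω| ^ (2 + δ)) ∂P).toReal with hR
    refine (limsup_le_limsup (hlarge.mono fun n hn => iSup₂_le fun P hP => ?_)).trans
      ((hlim (2 ^ (2 + δ - 1) * (R + (1 + R) ^ (2 + δ)))).limsup_eq.le.trans zero_le_one)
    have hid := hiid P hP
    have := hid.isProbabilityMeasure
    have hX0 := (hid.measurable 0).aemeasurable (μ := P)
    obtain ⟨-, h1, h2, -⟩ := hlaw P hP
    refine postHocRisk_rwsInterval_le_of_isIID hδ hC hρ hid (hlaw P hP) ?_ hn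
    refine integral_abs_sub_rpow_le (by linarith) (hid.measurable 0)
      ((integrable_map_measure (by fun_prop) hX0).1 h1) ?_ ENNReal.toReal_nonneg ?_
    · rw [← h2, integral_map hX0 (by fun_prop)]
    · rw [hR, ENNReal.ofReal_toReal (ne_of_lt hB)]
      exact le_iSup₂_of_le P hP le_rfl
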